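/- Let $M$ be a smooth manifold (without boundary) of dimension $n\ge 0$, and let $\omega$ be a smooth differential form on $M$ that is either - a volume form, i.e. an $n$-form with $\omega_p\neq 0$ for every $p\in M$, or - a symplectic form, i.e. a $2$-form that is closed ($d\omega=0$) and non-degenerate (for every $p\in M$ the linear map $T_pM\to T_p^*M$, $v\mapsto \iota_v\omega_p=\omega_p(v,\cdot)$, is injective). Then $\omega$ is flat. Here a $k$-form $\omega$ on $M$ is called flat if every point $p\in M$ admits smooth local coordinates $\phi:U\to M$ near $p$ (a diffeomorphism from an open set $U\subset\mathbb R^n$ onto an open neighbourhood of $p$) such that $\phi^*\omega$ has constant coefficients on $U$, i.e. $$\phi^*\omega=\sum_{1\le i_1<\dots<i_k\le n}\lambda_{i_1,\dots,i_k}\,dx_{i_1}\wedge\dots\wedge dx_{i_k}$$ with constants $\lambda_{i_1,\dots,i_k}\in\mathbb R$. -/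

import Mathlib

open scoped Manifold ContDiff

noncomputable section

namespace Darboux

/-- The coordinate space `ℝⁿ`. -/
abbrev Coord (n : ℕ) : Type := EuclideanSpace ℝ (Fin n)

/-- A (not necessarily smooth) field of alternating `k`-forms on the tangent spaces of `M`. -/
abbrev FormField (n k : ℕ) (M : Type*) [TopologicalSpace M] [ChartedSpace (Coord n) M] : Type _ :=
  (p : M) → TangentSpace (𝓡 n) p [⋀^Fin k]→L[ℝ] ℝ

/-- The expression of `η` in the coordinates `e`: the pullback `φ^*η` of `η` along the local
parametrization `φ = e.symm`, i.e. `(φ^*η)_x (v₁, …, v_k) = η_{φ x} (dφ_x v₁, …, dφ_x v_k)`.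
It is meaningful on `e.target`, the domain of `φ`. -/
def inChart {n k : ℕ} {M : Type*} [TopologicalSpace M] [ChartedSpace (Coord n) M]
    (η : FormField n k M) (e : OpenPartialHomeomorph M (Coord n)) (x : Coord n) :
    Coord n [⋀^Fin k]→L[ℝ] ℝ :=
  (η (e.symm x)).compContinuousLinearMap (mfderiv (𝓡 n) (𝓡 n) e.symm x)

/-- A smooth differential `k`-form on the `n`-dimensional manifold `M`: in all coordinates of the
smooth structure, its coordinate expression is a smooth function on the coordinate domain. -/
structure DifferentialForm (n k : ℕ) (M : Type*) [TopologicalSpace M] [ChartedSpace (Coord n) M]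
    where
  /-- The value of the form at a point. -/
  toField : FormField n k M
  smooth : ∀ e ∈ IsManifold.maximalAtlas (𝓡 n) ∞ M, ContDiffOn ℝ ∞ (inChart toField e) e.target

namespace DifferentialForm

variable {n k : ℕ} {M : Type*} [TopologicalSpace M] [ChartedSpace (Coord n) M]

/-- `dη = 0`: the exterior derivative vanishes, computed in all coordinates. -/
def IsClosed (η : DifferentialForm n k M) : Prop :=
  ∀ e ∈ IsManifold.maximalAtlas (𝓡 n) ∞ M, ∀ x ∈ e.target, extDeriv (inChart η.toField e) x = 0

/-- At every point `p`, the map `v ↦ ι_v η_p = η_p (v, ·, …, ·)` is injective on `T_p M`. -/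
def IsNondegenerate (η : DifferentialForm n (k + 1) M) : Prop :=
  ∀ p : M, Function.Injective fun v : TangentSpace (𝓡 n) p =>
    (η.toField p).toAlternatingMap.curryLeft v

/-- A symplectic form: a closed non-degenerate `2`-form. -/
def IsSymplectic (η : DifferentialForm n 2 M) : Prop :=
  η.IsClosed ∧ η.IsNondegenerate

/-- A volume form: a nowhere vanishing form of top degree. -/
def IsVolumeForm (η : DifferentialForm n n M) : Prop :=
  ∀ p : M, η.toField p ≠ 0

/-- `η` is flat at `p`: there are local coordinates near `p` in which `η` has constant
coefficients, i.e. its coordinate expression is the same alternating form on `ℝⁿ` at all points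
of the coordinate domain. -/
def IsFlatAt (η : DifferentialForm n k M) (p : M) : Prop :=
  ∃ e ∈ IsManifold.maximalAtlas (𝓡 n) ∞ M, p ∈ e.source ∧
    ∃ c : Coord n [⋀^Fin k]→L[ℝ] ℝ, ∀ x ∈ e.target, inChart η.toField e x = c

/-- `η` is flat: it is flat at every point. -/
def IsFlat (η : DifferentialForm n k M) : Prop :=
  ∀ p : M, η.IsFlatAt p

end DifferentialForm

end Darboux

end

open scoped Manifold ContDiff
open Set Topology Filter

universe u

/-! Around any point take a chart centred there; it is enough to find flat coordinates near `0` in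
`ℝⁿ`. A volume form is `f dx₁ ∧ … ∧ dxₙ` with `f` nonvanishing near `0`. If `g` satisfies `∂₁g = f`,
then replacing the first coordinate by `g` has Jacobian determinant `f`, and in the new coordinates
the form has coefficient `1` (`hasFlatCoordinates_of_ne_zero`). For a symplectic form `B`, Moser's
trick is used. The difference `β = B - B 0` is closed, so `β = dα` near `0` with `α` vanishing to
second order there (`exists_primitive_oneForm`). Let `X` solve `ι_X (B 0 + t β) = -α`. Along the
flow of `X` the pullback of `B 0 + t β` has zero time derivative (`apply_curves_eq_of_moser`), so
the time-one map pulls `B` back to `B 0`. The flow comes with its smooth dependence on the initial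
point from the inverse function theorem in the Banach space of curves `C([0,1], E)`, applied to the
integral equation (`exists_flow`). This rests on the smoothness of `γ ↦ f ∘ γ`
(`contDiffOn_superposition`), which also yields differentiation under the integral sign. -/

namespace Darboux

/-! ### Smoothness of superposition operators on spaces of continuous maps. -/

section Superposition

variable {K : Type*} [TopologicalSpace K] [CompactSpace K]

variable (K) in
/-- Pointwise application of a curve of operators to a curve of vectors. -/
noncomputable def pointwiseApply (G F : Type*) [NormedAddCommGroup G] [NormedSpace ℝ G]
    [NormedAddCommGroup F] [NormedSpace ℝ F] :
    C(K, G →L[ℝ] F) →L[ℝ] C(K, G) →L[ℝ] C(K, F) :=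
  LinearMap.mkContinuous₂
    (LinearMap.mk₂ ℝ (fun (A : C(K, G →L[ℝ] F)) (h : C(K, G)) =>
        (⟨fun t => A t (h t), by fun_prop⟩ : C(K, F)))
      (fun _ _ _ => by ext; simp) (fun _ _ _ => by ext; simp)
      (fun _ _ _ => by ext; simp) (fun _ _ _ => by ext; simp)) 1
    (fun A h => by
      refine (ContinuousMap.norm_le _ (by positivity)).2 fun t => ?_
      calc ‖A t (h t)‖ ≤ ‖A t‖ * ‖h t‖ := (A t).le_opNorm _
        _ ≤ 1 * ‖A‖ * ‖h‖ := by
          rw [one_mul]; gcongr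
          · exact A.norm_coe_le_norm t
          · exact h.norm_coe_le_norm t)

@[simp]
theorem pointwiseApply_apply {G F : Type*} [NormedAddCommGroup G] [NormedSpace ℝ G]
    [NormedAddCommGroup F] [NormedSpace ℝ F] (A : C(K, G →L[ℝ] F)) (h : C(K, G)) (t : K) :
    pointwiseApply K G F A h t = A t (h t) := rfl

open Classical in
/-- The superposition operator `γ ↦ f ∘ γ`, with value `0` where `f ∘ γ` is not continuous. -/
noncomputable def superposition {G F : Type*} [TopologicalSpace G] [TopologicalSpace F] [Zero F]
    (f : G → F) (γ : C(K, G)) : C(K, F) :=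
  if h : Continuous (f ∘ γ) then ⟨f ∘ γ, h⟩ else 0

variable {G F : Type u} [NormedAddCommGroup G] [NormedSpace ℝ G]
    [NormedAddCommGroup F] [NormedSpace ℝ F] {f : G → F} {W : Set G}

omit [CompactSpace K] [NormedSpace ℝ G] [NormedSpace ℝ F] in
theorem superposition_apply (hf : ContinuousOn f W) {γ : C(K, G)} (hγ : ∀ t, γ t ∈ W) (t : K) :
    superposition f γ t = f (γ t) := by
  have h : Continuous (f ∘ γ) := hf.comp_continuous γ.continuous hγ
  simp [superposition, h]

omit [NormedSpace ℝ G] in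
theorem isOpen_setOf_forall_mem (hW : IsOpen W) : IsOpen {γ : C(K, G) | ∀ t, γ t ∈ W} := by
  simpa [MapsTo] using ContinuousMap.isOpen_setOfPred_mapsTo (X := K) (Y := G) isCompact_univ hW

/-- The first-order remainder of `f` is small uniformly near the compact range of `γ`, so the
pointwise derivative is also the derivative in the sup norm. -/
theorem hasFDerivAt_superposition (hW : IsOpen W) (hf : ContDiffOn ℝ ∞ f W) {γ : C(K, G)}
    (hγ : ∀ t, γ t ∈ W) :
    HasFDerivAt (superposition f) (pointwiseApply K G F (superposition (fderiv ℝ f) γ)) γ := by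
  have hf' : ContinuousOn (fderiv ℝ f) W := hf.continuousOn_fderiv_of_isOpen hW (by simp)
  rw [hasFDerivAt_iff_isLittleO_nhds_zero, Asymptotics.isLittleO_iff]
  intro ε hε
  -- Strict differentiability at each `γ t` and continuity of the derivative give the bound locally
  -- in `z`; compactness makes it uniform.
  have key : ∀ᶠ h in 𝓝 (0 : G), ∀ z ∈ range γ,
      ‖f (z + h) - f z - fderiv ℝ f z h‖ ≤ ε * ‖h‖ := by
    refine (isCompact_range γ.continuous).eventually_forall_of_forall_eventually ?_
    rintro _ ⟨t, rfl⟩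
    have hfa : ContDiffAt ℝ ∞ f (γ t) := hf.contDiffAt (hW.mem_nhds (hγ t))
    have h1 := (hfa.hasStrictFDerivAt (by simp)).isLittleO
    rw [Asymptotics.isLittleO_iff] at h1
    have h1 := h1 (half_pos hε)
    have h2 : ∀ᶠ z in 𝓝 (γ t), ‖fderiv ℝ f z - fderiv ℝ f (γ t)‖ < ε / 2 := by
      have := (hf'.continuousAt (hW.mem_nhds (hγ t))).eventually (Metric.ball_mem_nhds _ (half_pos hε))
      simpa [dist_eq_norm] using this
    have c1 : Tendsto (fun p : G × G => (p.2 + p.1, p.2)) (𝓝 (0, γ t)) (𝓝 (γ t, γ t)) := by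
      have : Continuous (fun p : G × G => (p.2 + p.1, p.2)) := by fun_prop
      simpa using this.tendsto (0, γ t)
    have c2 : Tendsto (fun p : G × G => p.2) (𝓝 (0, γ t)) (𝓝 (γ t)) := continuous_snd.tendsto _
    filter_upwards [c1.eventually h1, c2.eventually h2] with p hp1 hp2
    simp only [add_sub_cancel_left] at hp1
    calc ‖f (p.2 + p.1) - f p.2 - fderiv ℝ f p.2 p.1‖
        = ‖(f (p.2 + p.1) - f p.2 - fderiv ℝ f (γ t) p.1)
            - (fderiv ℝ f p.2 - fderiv ℝ f (γ t)) p.1‖ := by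
          congr 1; simp
      _ ≤ ε / 2 * ‖p.1‖ + ε / 2 * ‖p.1‖ := by
          refine (norm_sub_le _ _).trans (add_le_add hp1 ?_)
          exact ((fderiv ℝ f p.2 - fderiv ℝ f (γ t)).le_opNorm _).trans (by gcongr)
      _ = ε * ‖p.1‖ := by ring
  obtain ⟨δ, hδ, hδk⟩ := Metric.eventually_nhds_iff.1 key
  have hop := (isOpen_setOf_forall_mem (K := K) hW).mem_nhds hγ
  have hop' : ∀ᶠ h in 𝓝 (0 : C(K, G)), ∀ t, (γ + h) t ∈ W := by
    have : Tendsto (fun h : C(K, G) => γ + h) (𝓝 0) (𝓝 γ) := by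
      simpa using (continuous_const_add γ).tendsto (0 : C(K, G))
    exact this.eventually hop
  filter_upwards [hop', Metric.ball_mem_nhds (0 : C(K, G)) hδ] with h h1 h2
  refine (ContinuousMap.norm_le _ (by positivity)).2 fun t => ?_
  have hht : ‖h t‖ ≤ ‖h‖ := h.norm_coe_le_norm t
  have h3 := hδk (y := h t) (by simp at h2 ⊢; exact hht.trans_lt h2) (γ t) ⟨t, rfl⟩
  simp only [ContinuousMap.sub_apply, pointwiseApply_apply,
    superposition_apply hf.continuousOn h1, superposition_apply hf.continuousOn hγ,
    superposition_apply hf' hγ]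
  exact h3.trans (by gcongr)

/-- The derivative is the superposition operator of `fderiv ℝ f` followed by a bounded linear map,
which allows induction on the order of smoothness. The target changes from `F` to `G →L[ℝ] F` at
each step, hence the common universe. -/
theorem contDiffOn_superposition (hW : IsOpen W) (hf : ContDiffOn ℝ ∞ f W) :
    ContDiffOn ℝ ∞ (superposition f) {γ : C(K, G) | ∀ t, γ t ∈ W} := by
  rw [contDiffOn_infty]
  intro n
  have hO := isOpen_setOf_forall_mem (K := K) hW
  induction n generalizing F with
  | zero =>
    exact contDiffOn_zero.2 fun γ hγ =>
      (hasFDerivAt_superposition hW hf hγ).continuousAt.continuousWithinAt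
  | succ n ih =>
    push_cast
    rw [contDiffOn_succ_iff_fderiv_of_isOpen hO]
    refine ⟨fun γ hγ =>
      (hasFDerivAt_superposition hW hf hγ).differentiableAt.differentiableWithinAt, by simp, ?_⟩
    refine ((pointwiseApply K G F).contDiff.comp_contDiffOn
      (ih (hf.fderiv_of_isOpen hW (m := ∞) (by simp)))).congr fun γ hγ => ?_
    exact (hasFDerivAt_superposition hW hf hγ).fderiv

end Superposition

/-! ### Integration of curves and integrals depending on a parameter. -/

section ParametricIntegral

/-- The primitive of a curve on `[0, 1]` that vanishes at `0`. -/
noncomputable def primitive (F : Type*) [NormedAddCommGroup F] [NormedSpace ℝ F] :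
    C(Icc (0 : ℝ) 1, F) →L[ℝ] C(Icc (0 : ℝ) 1, F) :=
  LinearMap.mkContinuous
    { toFun := fun g => ⟨fun t => ∫ s in (0 : ℝ)..t, IccExtend zero_le_one g s, by
        have := intervalIntegral.continuous_primitive (μ := MeasureTheory.volume)
          (fun a b => (g.continuous.Icc_extend' (h := zero_le_one)).intervalIntegrable a b) 0
        exact this.comp continuous_subtype_val⟩
      map_add' := fun g h => by
        ext t
        simp only [ContinuousMap.coe_mk, ContinuousMap.add_apply]
        rw [← intervalIntegral.integral_add
          ((g.continuous.Icc_extend' (h := zero_le_one)).intervalIntegrable _ _)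
          ((h.continuous.Icc_extend' (h := zero_le_one)).intervalIntegrable _ _)]
        rfl
      map_smul' := fun c g => by
        ext t
        simp only [ContinuousMap.coe_mk, ContinuousMap.smul_apply, RingHom.id_apply]
        rw [← intervalIntegral.integral_smul]
        rfl } 1
    (fun g => by
      refine (ContinuousMap.norm_le _ (by positivity)).2 fun t => ?_
      have h := intervalIntegral.norm_integral_le_of_norm_le_const (a := 0) (b := (t : ℝ))
        (f := IccExtend zero_le_one g) (C := ‖g‖) (fun s _ => g.norm_coe_le_norm _)
      refine h.trans ?_
      rw [sub_zero, abs_of_nonneg t.2.1, mul_comm]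
      gcongr
      exact t.2.2)

variable {E F : Type u} [NormedAddCommGroup E] [NormedSpace ℝ E]
  [NormedAddCommGroup F] [NormedSpace ℝ F]

theorem primitive_apply (g : C(Icc (0 : ℝ) 1, F)) (t : Icc (0 : ℝ) 1) :
    primitive F g t = ∫ s in (0 : ℝ)..t, IccExtend zero_le_one g s := rfl

theorem hasDerivWithinAt_primitive [CompleteSpace F] (g : C(Icc (0 : ℝ) 1, F))
    (t : Icc (0 : ℝ) 1) :
    HasDerivWithinAt (IccExtend zero_le_one (primitive F g)) (g t) (Icc 0 1) t := by
  have hc := g.continuous.Icc_extend' (h := (zero_le_one : (0 : ℝ) ≤ 1))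
  have h := intervalIntegral.integral_hasDerivAt_right (hc.intervalIntegrable 0 (t : ℝ))
    (hc.stronglyMeasurableAtFilter _ _) hc.continuousAt
  have h2 := h.hasDerivWithinAt (s := Icc 0 1)
  rw [IccExtend_val] at h2
  refine h2.congr (fun s hs => ?_) ?_
  · rw [IccExtend_of_mem _ _ hs]; rfl
  · rw [IccExtend_val]; rfl

variable (E) in
/-- The constant curves, as a continuous linear map. -/
noncomputable def constCurve : E →L[ℝ] C(Icc (0 : ℝ) 1, E) :=
  LinearMap.mkContinuous
    { toFun := fun x => ContinuousMap.const _ x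
      map_add' := fun _ _ => rfl
      map_smul' := fun _ _ => rfl } 1
    (fun x => (ContinuousMap.norm_le _ (by positivity)).2 fun t => (one_mul ‖x‖).ge)

@[simp]
theorem constCurve_apply (x : E) (t : Icc (0 : ℝ) 1) : constCurve E x t = x := rfl

/-- The graph `t ↦ (t, γ t)` of a curve. -/
noncomputable def graphCurve (γ : C(Icc (0 : ℝ) 1, E)) : C(Icc (0 : ℝ) 1, ℝ × E) :=
  ⟨fun t => (t, γ t), by fun_prop⟩

omit [NormedSpace ℝ E] in
@[simp]
theorem graphCurve_apply (γ : C(Icc (0 : ℝ) 1, E)) (t : Icc (0 : ℝ) 1) :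
    graphCurve γ t = ((t : ℝ), γ t) := rfl

theorem graphCurve_eq : graphCurve (E := E) = fun γ =>
    (ContinuousLinearMap.inr ℝ ℝ E).compLeftContinuous ℝ (Icc (0 : ℝ) 1) γ + graphCurve 0 := by
  ext γ t <;> simp

theorem hasFDerivAt_graphCurve (γ : C(Icc (0 : ℝ) 1, E)) :
    HasFDerivAt graphCurve
      ((ContinuousLinearMap.inr ℝ ℝ E).compLeftContinuous ℝ (Icc (0 : ℝ) 1)) γ := by
  rw [graphCurve_eq]
  exact (ContinuousLinearMap.hasFDerivAt _).add_const _

theorem contDiff_graphCurve : ContDiff ℝ ∞ (graphCurve (E := E)) := by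
  rw [graphCurve_eq]
  exact (ContinuousLinearMap.contDiff _).add contDiff_const

variable {f : ℝ × E → F} {W : Set (ℝ × E)} {U : Set E}

theorem contDiffOn_superposition_graphCurve (hW : IsOpen W) (hf : ContDiffOn ℝ ∞ f W) :
    ContDiffOn ℝ ∞ (fun γ : C(Icc (0 : ℝ) 1, E) => superposition f (graphCurve γ))
      {γ | ∀ t : Icc (0 : ℝ) 1, ((t : ℝ), γ t) ∈ W} :=
  (contDiffOn_superposition hW hf).comp contDiff_graphCurve.contDiffOn fun _ hγ => hγ

/-- Derivative of the superposition operator of a time-dependent map. -/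
noncomputable def superpositionDeriv (f : ℝ × E → F) (γ : C(Icc (0 : ℝ) 1, E)) :
    C(Icc (0 : ℝ) 1, E) →L[ℝ] C(Icc (0 : ℝ) 1, F) :=
  (pointwiseApply _ (ℝ × E) F (superposition (fderiv ℝ f) (graphCurve γ))).comp
    ((ContinuousLinearMap.inr ℝ ℝ E).compLeftContinuous ℝ (Icc (0 : ℝ) 1))

theorem superpositionDeriv_apply (hW : IsOpen W) (hf : ContDiffOn ℝ ∞ f W)
    {γ : C(Icc (0 : ℝ) 1, E)} (hγ : ∀ t : Icc (0 : ℝ) 1, ((t : ℝ), γ t) ∈ W)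
    (h : C(Icc (0 : ℝ) 1, E)) (t : Icc (0 : ℝ) 1) :
    superpositionDeriv f γ h t = fderiv ℝ f (t, γ t) (0, h t) := by
  have hf' : ContinuousOn (fderiv ℝ f) W := hf.continuousOn_fderiv_of_isOpen hW (by simp)
  simp [superpositionDeriv, superposition_apply hf' (γ := graphCurve γ) hγ]

theorem hasFDerivAt_superposition_graphCurve (hW : IsOpen W) (hf : ContDiffOn ℝ ∞ f W)
    {γ : C(Icc (0 : ℝ) 1, E)} (hγ : ∀ t : Icc (0 : ℝ) 1, ((t : ℝ), γ t) ∈ W) :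
    HasFDerivAt (fun γ => superposition f (graphCurve γ)) (superpositionDeriv f γ) γ :=
  (hasFDerivAt_superposition hW hf (γ := graphCurve γ) hγ).comp γ (hasFDerivAt_graphCurve γ)

theorem integral_eq_primitive (hf : ContinuousOn f W) {x : E}
    (hx : ∀ t ∈ Icc (0 : ℝ) 1, (t, x) ∈ W) :
    ∫ t in (0 : ℝ)..1, f (t, x) =
      primitive F (superposition f (graphCurve (constCurve E x))) ⟨1, by simp⟩ := by
  rw [primitive_apply]
  refine intervalIntegral.integral_congr fun t ht => ?_
  rw [uIcc_of_le zero_le_one] at ht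
  rw [IccExtend_of_mem _ _ ht, superposition_apply hf (γ := graphCurve (constCurve E x)) (fun s => hx s s.2)]
  rfl

/-- The integral is a composite of smooth maps: constant curve, superposition by `f`, primitive,
evaluation at `1`. The chain rule for this composite is differentiation under the integral sign. -/
theorem contDiffOn_parametric_integral (hW : IsOpen W) (hf : ContDiffOn ℝ ∞ f W)
    (hU : ∀ x ∈ U, ∀ t ∈ Icc (0 : ℝ) 1, (t, x) ∈ W) :
    ContDiffOn ℝ ∞ (fun x => ∫ t in (0 : ℝ)..1, f (t, x)) U := by
  have h := (contDiffOn_superposition_graphCurve hW hf).comp (constCurve E).contDiff.contDiffOn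
    (s := U) (fun x hx t => hU x hx t t.2)
  have h2 := ((ContinuousMap.evalCLM ℝ (⟨1, by simp⟩ : Icc (0 : ℝ) 1)).comp
    (primitive F)).contDiff.comp_contDiffOn h
  exact h2.congr fun x hx => integral_eq_primitive hf.continuousOn (hU x hx)

theorem fderiv_parametric_integral_apply (hW : IsOpen W) (hf : ContDiffOn ℝ ∞ f W)
    (hUo : IsOpen U) (hU : ∀ x ∈ U, ∀ t ∈ Icc (0 : ℝ) 1, (t, x) ∈ W) {x : E} (hx : x ∈ U) (v : E) :
    fderiv ℝ (fun x => ∫ t in (0 : ℝ)..1, f (t, x)) x v =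
      ∫ t in (0 : ℝ)..1, fderiv ℝ f (t, x) (0, v) := by
  have hxt : ∀ t : Icc (0 : ℝ) 1, ((t : ℝ), constCurve E x t) ∈ W := fun t => hU x hx t t.2
  have h := (hasFDerivAt_superposition_graphCurve hW hf hxt).comp x (constCurve E).hasFDerivAt
  have h2 := ((ContinuousMap.evalCLM ℝ (⟨1, by simp⟩ : Icc (0 : ℝ) 1)).comp
    (primitive F)).hasFDerivAt.comp x h
  have h3 := h2.congr_of_eventuallyEq (f₁ := fun x => ∫ t in (0 : ℝ)..1, f (t, x)) (by
    filter_upwards [hUo.mem_nhds hx] with y hy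
    exact integral_eq_primitive hf.continuousOn (hU y hy))
  rw [h3.fderiv]
  simp only [ContinuousLinearMap.comp_apply, ContinuousMap.evalCLM_apply]
  rw [primitive_apply]
  refine intervalIntegral.integral_congr fun t ht => ?_
  rw [uIcc_of_le zero_le_one] at ht
  rw [IccExtend_of_mem _ _ ht, superpositionDeriv_apply hW hf hxt]
  rfl

end ParametricIntegral
-- Local diffeomorphisms and reduction to coordinate space.
/-- A smooth map with invertible derivative at a point restricts to a diffeomorphism
between open sets. -/
theorem exists_openPartialHomeomorph_contDiffOn {E : Type*} [NormedAddCommGroup E]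
    [NormedSpace ℝ E] [CompleteSpace E] {F : Type*} [NormedAddCommGroup F]
    [NormedSpace ℝ F] {f : E → F} {U : Set E} (hU : IsOpen U)
    (hf : ContDiffOn ℝ ∞ f U) {a : E} (ha : a ∈ U) {f' : E ≃L[ℝ] F}
    (hf' : HasFDerivAt f (f' : E →L[ℝ] F) a) :
    ∃ φ : OpenPartialHomeomorph E F, a ∈ φ.source ∧ φ.source ⊆ U ∧ ⇑φ = f ∧
      ContDiffOn ℝ ∞ φ φ.source ∧ ContDiffOn ℝ ∞ φ.symm φ.target := by
  have hfa : ContDiffAt ℝ ∞ f a := hf.contDiffAt (hU.mem_nhds ha)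
  set ψ := hfa.toOpenPartialHomeomorph f hf' (by simp)
  have hψ : ⇑ψ = f := rfl
  -- Keeping only points with invertible derivative makes the inverse smooth on the whole target,
  -- not just at the image of `a`.
  set V := U ∩ fderiv ℝ f ⁻¹' range ((↑) : (E ≃L[ℝ] F) → E →L[ℝ] F)
  have hV : IsOpen V := (hf.continuousOn_fderiv_of_isOpen hU (by simp)).isOpen_inter_preimage hU
    ContinuousLinearEquiv.isOpen
  have hsrc : (ψ.restr V).source = ψ.source ∩ V := by
    rw [OpenPartialHomeomorph.restr_source, hV.interior_eq]
  refine ⟨ψ.restr V, ?_, ?_, hψ, ?_, ?_⟩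
  · rw [hsrc]
    exact ⟨hfa.mem_toOpenPartialHomeomorph_source hf' (by simp), ha, f', hf'.fderiv.symm⟩
  · rw [hsrc]; exact fun x hx => hx.2.1
  · rw [hsrc]; exact hf.mono fun x hx => hx.2.1
  · intro y hy
    have hy' := (ψ.restr V).map_target hy
    rw [hsrc] at hy'
    obtain ⟨-, hyU, g', hg'⟩ := hy'
    have hc : ContDiffAt ℝ ∞ f ((ψ.restr V).symm y) := hf.contDiffAt (hU.mem_nhds hyU)
    have hd : HasFDerivAt f (g' : E →L[ℝ] F) ((ψ.restr V).symm y) := by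
      rw [hg']; exact (hc.differentiableAt (by simp)).hasFDerivAt
    exact ((ψ.restr V).contDiffAt_symm hy hd hc).contDiffWithinAt

/-- A neighbourhood of a slice `[0, 1] × {a}` contains a tube `[0, 1] × V`. -/
theorem exists_isOpen_forall_mem_Icc {E : Type*} [TopologicalSpace E] {W : Set (ℝ × E)}
    (hW : IsOpen W) {a : E} (ha : ∀ t ∈ Icc (0 : ℝ) 1, (t, a) ∈ W) :
    ∃ V : Set E, IsOpen V ∧ a ∈ V ∧ ∀ x ∈ V, ∀ t ∈ Icc (0 : ℝ) 1, (t, x) ∈ W := by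
  have h : ∀ᶠ x in 𝓝 a, ∀ t ∈ Icc (0 : ℝ) 1, (t, x) ∈ W := by
    refine isCompact_Icc.eventually_forall_of_forall_eventually fun t ht => ?_
    exact continuous_swap.continuousAt.eventually (hW.mem_nhds (ha t ht))
  obtain ⟨V, hV, hVo, haV⟩ := eventually_nhds_iff.1 h
  exact ⟨V, hVo, haV, hV⟩

/-- Near `0` there are coordinates `φ` with values in `U` such that `φ^*η` is constant. -/
def HasFlatCoordinates {n k : ℕ} (η : Coord n → Coord n [⋀^Fin k]→L[ℝ] ℝ) (U : Set (Coord n)) :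
    Prop :=
  ∃ φ : OpenPartialHomeomorph (Coord n) (Coord n),
    0 ∈ φ.target ∧ φ.target ⊆ U ∧ ContDiffOn ℝ ∞ φ φ.source ∧ ContDiffOn ℝ ∞ φ.symm φ.target ∧
      ∃ c : Coord n [⋀^Fin k]→L[ℝ] ℝ, ∀ y ∈ φ.source,
        (η (φ y)).compContinuousLinearMap (fderiv ℝ φ y) = c

variable {n k : ℕ} {M : Type*} [TopologicalSpace M] [ChartedSpace (Coord n) M]
  [IsManifold (𝓡 n) ∞ M]

theorem trans_mem_maximalAtlas {e : OpenPartialHomeomorph M (Coord n)}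
    (he : e ∈ IsManifold.maximalAtlas (𝓡 n) ∞ M)
    {ψ : OpenPartialHomeomorph (Coord n) (Coord n)} (h : ContDiffOn ℝ ∞ ψ ψ.source)
    (h' : ContDiffOn ℝ ∞ ψ.symm ψ.target) :
    e.trans ψ ∈ IsManifold.maximalAtlas (𝓡 n) ∞ M := by
  refine OpenPartialHomeomorph.mem_maximalAtlas_of_contMDiffOn _ ?_ ?_
  · exact h.contMDiffOn.comp ((contMDiffOn_of_mem_maximalAtlas he).mono inter_subset_left) inter_subset_right
  · exact (contMDiffOn_symm_of_mem_maximalAtlas he).comp (h'.contMDiffOn.mono inter_subset_left) inter_subset_right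

/-- Every point is the centre of some coordinate system. -/
theorem exists_centered_chart (p : M) :
    ∃ e ∈ IsManifold.maximalAtlas (𝓡 n) ∞ M, p ∈ e.source ∧ e p = 0 := by
  set e := chartAt (Coord n) p
  refine ⟨e.trans (Homeomorph.addRight (-e p)).toOpenPartialHomeomorph,
    trans_mem_maximalAtlas (IsManifold.chart_mem_maximalAtlas p) ?_ ?_, ?_, ?_⟩
  · exact (contDiff_id.add contDiff_const).contDiffOn
  · exact (contDiff_id.add contDiff_const).contDiffOn
  · simp [e]
  · simp

omit [IsManifold (𝓡 n) ∞ M] in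
theorem inChart_trans_symm (η : FormField n k M)
    {e : OpenPartialHomeomorph M (Coord n)}
    (he : e ∈ IsManifold.maximalAtlas (𝓡 n) ∞ M)
    {φ : OpenPartialHomeomorph (Coord n) (Coord n)} (h : ContDiffOn ℝ ∞ φ φ.source)
    {y : Coord n} (hy : y ∈ φ.source) (hy' : φ y ∈ e.target) :
    inChart η (e.trans φ.symm) y =
      (inChart η e (φ y)).compContinuousLinearMap (fderiv ℝ φ y) := by
  have h1 : MDifferentiableAt (𝓡 n) (𝓡 n) e.symm (φ y) :=
    (contMDiffAt_symm_of_mem_maximalAtlas he hy').mdifferentiableAt (by simp)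
  have h2 : DifferentiableAt ℝ φ y :=
    (h.contDiffAt (φ.open_source.mem_nhds hy)).differentiableAt (by simp)
  have h3 := mfderiv_comp y h1 h2.mdifferentiableAt
  rw [mfderiv_eq_fderiv] at h3
  have h4 : mfderiv (𝓡 n) (𝓡 n) (e.trans φ.symm).symm y =
      (mfderiv (𝓡 n) (𝓡 n) e.symm (φ y)).comp (fderiv ℝ φ y) := h3
  unfold inChart
  rw [h4]
  rfl

theorem DifferentialForm.isFlatAt_of_hasFlatCoordinates (η : DifferentialForm n k M) {p : M}
    {e : OpenPartialHomeomorph M (Coord n)} (he : e ∈ IsManifold.maximalAtlas (𝓡 n) ∞ M)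
    (hp : p ∈ e.source) (hp0 : e p = 0)
    (h : HasFlatCoordinates (inChart η.toField e) e.target) : η.IsFlatAt p := by
  obtain ⟨φ, h0, hsub, hφ, hφ', c, hc⟩ := h
  refine ⟨e.trans φ.symm, trans_mem_maximalAtlas he hφ' hφ, ?_, c, fun y hy => ?_⟩
  · simp [hp, hp0, h0]
  · have hy1 : y ∈ φ.source := by simpa using hy.1
    rw [inChart_trans_symm η.toField he hφ hy1 (hsub (φ.map_source hy1)), hc y hy1]

/-! ### Volume forms. -/

theorem map_comp_eq_det_mul {n : ℕ} {E : Type*} [AddCommGroup E] [Module ℝ E]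
    (b : Module.Basis (Fin n) ℝ E) (c : E [⋀^Fin n]→ₗ[ℝ] ℝ) (A : E →ₗ[ℝ] E) (v : Fin n → E) :
    c (A ∘ v) = LinearMap.det A * c v := by
  rw [c.eq_smul_basis_det b]
  simp only [AlternatingMap.smul_apply, smul_eq_mul, Module.Basis.det_comp]
  ring

/-- Straightening a function along a vector `e`: a primitive of `f` in the direction `e`. -/
theorem exists_fderiv_apply_eq {E : Type} [NormedAddCommGroup E] [NormedSpace ℝ E]
    {f : E → ℝ} {U : Set E} (hU : IsOpen U) (hU0 : 0 ∈ U) (hf : ContDiffOn ℝ ∞ f U)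
    (π : E →L[ℝ] ℝ) {e : E} (he : π e = 1) :
    ∃ (g : E → ℝ) (V : Set E), IsOpen V ∧ 0 ∈ V ∧ V ⊆ U ∧ ContDiffOn ℝ ∞ g V ∧
      ∀ x ∈ V, fderiv ℝ g x e = f x := by
  -- `σ (t, x)` multiplies the `π`-coordinate of `x` by `t` along the line in direction `e`. The
  -- integral of `π x * f (σ (t, x))` is thus that of `f` along this line from `ker π` to `x`,
  -- rescaled to `[0, 1]`.
  set σ : ℝ × E → E := fun p => p.2 + ((p.1 - 1) * π p.2) • e
  have hσ : ContDiff ℝ ∞ σ := by fun_prop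
  set W := σ ⁻¹' U
  have hW : IsOpen W := hU.preimage hσ.continuous
  obtain ⟨V, hVo, h0V, hV⟩ := exists_isOpen_forall_mem_Icc hW (a := 0)
    (fun t _ => by simpa [W, σ] using hU0)
  set F : ℝ × E → ℝ := fun p => π p.2 * f (σ p)
  have hfσ : ContDiffOn ℝ ∞ (fun p => f (σ p)) W := hf.comp hσ.contDiffOn fun _ h => h
  have hF : ContDiffOn ℝ ∞ F W := (π.contDiff.comp contDiff_snd).contDiffOn.mul hfσ
  refine ⟨fun x => ∫ t in (0 : ℝ)..1, F (t, x), V, hVo, h0V, fun x hx => ?_,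
    contDiffOn_parametric_integral hW hF hV, fun x hx => ?_⟩
  · simpa [W, σ] using hV x hx 1 (by simp)
  rw [fderiv_parametric_integral_apply hW hF hVo hV hx]
  have hσ' : ∀ t : ℝ, HasFDerivAt σ (ContinuousLinearMap.snd ℝ ℝ E +
      ((t - 1) • π.comp (ContinuousLinearMap.snd ℝ ℝ E) +
        π x • ContinuousLinearMap.fst ℝ ℝ E).smulRight e) (t, x) := fun t => by
    have h1 : HasFDerivAt (fun p : ℝ × E => p.1 - 1) (ContinuousLinearMap.fst ℝ ℝ E) (t, x) :=
      hasFDerivAt_fst.sub_const 1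
    have h2 : HasFDerivAt (fun p : ℝ × E => π p.2) (π.comp (ContinuousLinearMap.snd ℝ ℝ E))
      (t, x) := (π.comp (ContinuousLinearMap.snd ℝ ℝ E)).hasFDerivAt
    exact hasFDerivAt_snd.add ((h1.mul h2).smul_const e)
  have hfd : ∀ t ∈ Icc (0 : ℝ) 1, HasFDerivAt f (fderiv ℝ f (σ (t, x))) (σ (t, x)) := fun t ht =>
    ((hf.contDiffAt (hU.mem_nhds (hV x hx t ht))).differentiableAt (by simp)).hasFDerivAt
  -- As `π e = 1`, the derivative of the integrand along `e` is the total `t`-derivative of `t * f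
  -- (σ (t, x))`, whose boundary values are `0` and `f x`.
  have key : ∀ t ∈ Icc (0 : ℝ) 1, HasDerivAt (fun s => s * f (σ (s, x)))
      (fderiv ℝ F (t, x) (0, e)) t := fun t ht => by
    have h1 := (hfd t ht).comp (t, x) (hσ' t)
    have h2 : HasFDerivAt (fun p : ℝ × E => π p.2) (π.comp (ContinuousLinearMap.snd ℝ ℝ E))
      (t, x) := (π.comp (ContinuousLinearMap.snd ℝ ℝ E)).hasFDerivAt
    have h3 : HasFDerivAt F _ (t, x) := h2.mul h1
    have h4 : HasDerivAt (fun s : ℝ => (s, x)) (1, 0) t :=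
      (hasDerivAt_id t).prodMk (hasDerivAt_const t x)
    have h5 : HasDerivAt (fun s => f (σ (s, x))) _ t :=
      HasFDerivAt.comp_hasDerivAt (l := f ∘ σ) (f := fun s => (s, x)) t h1 h4
    have h6 : HasDerivAt (fun s => s * f (σ (s, x))) _ t := (hasDerivAt_id t).mul h5
    rw [h3.fderiv]
    convert h6 using 1
    simp [he]
    ring
  have hcont : ContinuousOn (fun t => fderiv ℝ F (t, x) (0, e)) (uIcc 0 1) := by
    rw [uIcc_of_le zero_le_one]
    have h1 : ContinuousOn (fun t : ℝ => fderiv ℝ F (t, x)) (Icc 0 1) :=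
      (hF.continuousOn_fderiv_of_isOpen hW (by simp)).comp (by fun_prop) (hV x hx)
    exact h1.clm_apply continuousOn_const
  rw [intervalIntegral.integral_eq_sub_of_hasDerivAt (fun t ht => key t (by
    rwa [uIcc_of_le zero_le_one] at ht)) hcont.intervalIntegrable]
  simp [σ]

theorem hasFlatCoordinates_of_ne_zero {n : ℕ} {η : Coord n → Coord n [⋀^Fin n]→L[ℝ] ℝ}
    {U : Set (Coord n)} (hU : IsOpen U) (hU0 : 0 ∈ U) (hη : ContDiffOn ℝ ∞ η U)
    (h0 : η 0 ≠ 0) : HasFlatCoordinates η U := by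
  rcases n with _ | m
  -- In dimension `0` there is no direction to integrate along, but the space is a single point.
  · refine ⟨(OpenPartialHomeomorph.refl _).restr U, by simp [hU.interior_eq, hU0],
      by simp [hU.interior_eq], contDiff_id.contDiffOn, contDiff_id.contDiffOn, η 0,
      fun y _ => ?_⟩
    ext v
    simp only [OpenPartialHomeomorph.restr_apply, OpenPartialHomeomorph.refl_apply]
    rw [Subsingleton.elim y 0]
    simp only [ContinuousAlternatingMap.compContinuousLinearMap_apply]
    congr 1
    exact Subsingleton.elim _ _
  set b := (EuclideanSpace.basisFun (Fin (m + 1)) ℝ).toBasis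
  set e : Coord (m + 1) := EuclideanSpace.single 0 1
  set π : Coord (m + 1) →L[ℝ] ℝ := EuclideanSpace.proj 0
  have he : π e = 1 := by simp [π, e]
  have hf0 : η 0 b ≠ 0 := ((η 0).toAlternatingMap.map_basis_ne_zero_iff b).2 fun h =>
    h0 (ContinuousAlternatingMap.toAlternatingMap_injective h)
  set f : Coord (m + 1) → ℝ := fun x => η x b
  have hf : ContDiffOn ℝ ∞ f U :=
    (ContinuousAlternatingMap.apply ℝ (Coord (m + 1)) ℝ (b : Fin (m + 1) → _)).contDiff.comp_contDiffOn hη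
  obtain ⟨g, V, hVo, h0V, hVU, hg, hgf⟩ := exists_fderiv_apply_eq hU hU0 hf π he
  -- `ψ` replaces the coordinate `π x` by `g x`. Its derivative is a transvection, of determinant `1
  -- + (dg - π)(e) = f`.
  set ψ : Coord (m + 1) → Coord (m + 1) := fun x => x + (g x - π x) • e
  have hψ : ContDiffOn ℝ ∞ ψ V :=
    contDiffOn_id.add ((hg.sub π.contDiff.contDiffOn).smul contDiffOn_const)
  have hψ' : ∀ x ∈ V, HasFDerivAt ψ
      (ContinuousLinearMap.id ℝ _ + (fderiv ℝ g x - π).smulRight e) x := fun x hx =>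
    (hasFDerivAt_id x).add ((((hg.contDiffAt (hVo.mem_nhds hx)).differentiableAt
      (by simp)).hasFDerivAt.sub π.hasFDerivAt).smul_const e)
  have hdet : ∀ x ∈ V, LinearMap.det (fderiv ℝ ψ x : Coord (m + 1) →ₗ[ℝ] Coord (m + 1)) = f x := by
    intro x hx
    have : (fderiv ℝ ψ x : Coord (m + 1) →ₗ[ℝ] Coord (m + 1)) =
        LinearMap.transvection ((fderiv ℝ g x - π : Coord (m + 1) →L[ℝ] ℝ) : _ →ₗ[ℝ] ℝ) e := by
      rw [(hψ' x hx).fderiv]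
      rfl
    rw [this, LinearMap.transvection.det]
    simp [hgf x hx, he]
  obtain ⟨χ, h1, h2, h3, h4, h5⟩ := exists_openPartialHomeomorph_contDiffOn hVo hψ h0V
    (f' := (fderiv ℝ ψ 0).toContinuousLinearEquivOfDetNeZero
      (by rw [ContinuousLinearMap.det, hdet 0 h0V]; exact hf0))
    (by
      rw [ContinuousLinearMap.coe_toContinuousLinearEquivOfDetNeZero]
      exact (hψ' 0 h0V).differentiableAt.hasFDerivAt)
  -- The constant form is the one with value `1` on the basis `b`; its pullback by `ψ` is `det ψ' =
  -- f` times itself, which is `η`.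
  refine ⟨χ.symm, h1, h2.trans hVU, h5, h4, (f 0)⁻¹ • η 0, fun y hy => ?_⟩
  have hx : χ.symm y ∈ V := h2 (χ.map_target hy)
  have hd1 : HasFDerivAt χ.symm (fderiv ℝ χ.symm y) y :=
    ((h5.contDiffAt (χ.open_target.mem_nhds hy)).differentiableAt (by simp)).hasFDerivAt
  have hd2 : HasFDerivAt ψ (fderiv ℝ ψ (χ.symm y)) (χ.symm y) :=
    (hψ' _ hx).differentiableAt.hasFDerivAt
  have hid : (fderiv ℝ ψ (χ.symm y)).comp (fderiv ℝ χ.symm y) = ContinuousLinearMap.id ℝ _ := by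
    refine ((hd2.comp y hd1).congr_of_eventuallyEq ?_).unique (hasFDerivAt_id y)
    filter_upwards [χ.open_target.mem_nhds hy] with z hz
    exact (h3 ▸ χ.right_inv hz).symm
  have hpull : η (χ.symm y) =
      ((f 0)⁻¹ • η 0).compContinuousLinearMap (fderiv ℝ ψ (χ.symm y)) := by
    apply ContinuousAlternatingMap.toAlternatingMap_injective
    refine ((AlternatingMap.eq_smul_basis_det b _).trans ?_).trans
      (AlternatingMap.eq_smul_basis_det b _).symm
    have hscalar := map_comp_eq_det_mul b ((f 0)⁻¹ • η 0).toAlternatingMap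
      (fderiv ℝ ψ (χ.symm y) : Coord (m + 1) →ₗ[ℝ] Coord (m + 1)) b
    rw [hdet _ hx] at hscalar
    refine congrArg (· • b.det) (Eq.trans ?_ hscalar.symm)
    change f _ = f _ * ((f 0)⁻¹ * f 0)
    rw [inv_mul_cancel₀ hf0, mul_one]
  rw [hpull]
  ext v
  simp only [ContinuousAlternatingMap.compContinuousLinearMap_apply]
  congr 1
  ext1 i
  exact congrArg (fun L => L (v i)) hid

/-! ### Moser's method for closed nondegenerate 2-forms. -/

section Moser

variable {E : Type} [NormedAddCommGroup E] [NormedSpace ℝ E]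

theorem hasDerivWithinAt_id_smul {F : Type*} [NormedAddCommGroup F] [NormedSpace ℝ F] {f : ℝ → F}
    {f' : F} {s : Set ℝ} {t : ℝ} (h : HasDerivWithinAt f f' s t) :
    HasDerivWithinAt (fun r => r • f r) (t • f' + f t) s t := by
  simpa using (hasDerivWithinAt_id t s).fun_smul h

theorem _root_.HasFDerivAt.const_add_smul {F : Type*} [NormedAddCommGroup F] [NormedSpace ℝ F]
    {f : E → F} {f' : E →L[ℝ] F} {x : E} (h : HasFDerivAt f f' x) (c : F) (t : ℝ) :
    HasFDerivAt (fun r => c + t • f r) (t • f') x :=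
  (h.fun_const_smul t).const_add c

/-- Poincaré lemma for closed `2`-forms vanishing at the origin: there is a primitive that vanishes
to second order at the origin. -/
theorem exists_primitive_oneForm {β : E → E →L[ℝ] E →L[ℝ] ℝ} {U : Set E}
    (hU : IsOpen U) (hU0 : 0 ∈ U) (hβ : ContDiffOn ℝ ∞ β U) (hβ0 : β 0 = 0)
    (hskew : ∀ x ∈ U, ∀ v w, β x v w = -β x w v)
    (hclosed : ∀ x ∈ U, ∀ u v w,
      fderiv ℝ β x u v w - fderiv ℝ β x v u w + fderiv ℝ β x w u v = 0) :
    ∃ (α : E → E →L[ℝ] ℝ) (V : Set E), IsOpen V ∧ 0 ∈ V ∧ V ⊆ U ∧ ContDiffOn ℝ ∞ α V ∧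
      α 0 = 0 ∧ fderiv ℝ α 0 = 0 ∧
      ∀ x ∈ V, ∀ u w, fderiv ℝ α x u w - fderiv ℝ α x w u = β x u w := by
  set W : Set (ℝ × E) := (fun p : ℝ × E => p.1 • p.2) ⁻¹' U
  have hW : IsOpen W := hU.preimage (by fun_prop)
  obtain ⟨V, hVo, h0V, hV⟩ := exists_isOpen_forall_mem_Icc hW (a := 0)
    (fun t _ => by simpa [W] using hU0)
  -- The radial homotopy formula: `α x = ∫ t β_{tx}(x, ·) dt`.
  set F : ℝ × E → E →L[ℝ] ℝ := fun p => p.1 • β (p.1 • p.2) p.2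
  have hβW : ContDiffOn ℝ ∞ (fun p : ℝ × E => β (p.1 • p.2)) W :=
    hβ.comp (by fun_prop) fun _ h => h
  have hF : ContDiffOn ℝ ∞ F W := contDiffOn_fst.smul (hβW.clm_apply contDiffOn_snd)
  have hVU : V ⊆ U := fun x hx => by simpa [W] using hV x hx 1 (by simp)
  have hβd : ∀ y ∈ U, HasFDerivAt β (fderiv ℝ β y) y := fun y hy =>
    ((hβ.contDiffAt (hU.mem_nhds hy)).differentiableAt (by simp)).hasFDerivAt
  have hFd : ∀ t x u, (t, x) ∈ W → fderiv ℝ F (t, x) (0, u) =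
      t • (t • fderiv ℝ β (t • x) u x + β (t • x) u) := fun t x u htx => by
    have h1 : HasFDerivAt (fun y : E => (t, y)) (ContinuousLinearMap.inr ℝ ℝ E) x :=
      hasFDerivAt_prodMk_right t x
    have h2 : HasFDerivAt (fun y => F (t, y)) _ x :=
      (((hF.contDiffAt (hW.mem_nhds htx)).differentiableAt (by simp)).hasFDerivAt).comp x h1
    have h3 : HasFDerivAt (fun y : E => t • y) (t • ContinuousLinearMap.id ℝ E) x :=
      (hasFDerivAt_id x).const_smul t
    have h4 : HasFDerivAt (fun y => β (t • y)) _ x :=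
      HasFDerivAt.comp (g := β) (f := fun y : E => t • y) x (hβd (t • x) htx) h3
    have h5 : HasFDerivAt (fun y => F (t, y)) _ x := (h4.clm_apply (hasFDerivAt_id x)).const_smul t
    have h6 := congrArg (fun L => L u) (h2.unique h5)
    refine h6.trans ?_
    simp [add_comm]
  set α : E → E →L[ℝ] ℝ := fun x => ∫ t in (0 : ℝ)..1, F (t, x)
  have hα : ∀ x ∈ V, ∀ u, fderiv ℝ α x u =
      ∫ t in (0 : ℝ)..1, fderiv ℝ F (t, x) (0, u) := fun x hx u =>
    fderiv_parametric_integral_apply hW hF hVo hV hx u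
  have hcont : ∀ x ∈ V, ∀ u, ContinuousOn (fun t => fderiv ℝ F (t, x) (0, u)) (Icc 0 1) :=
    fun x hx u => by
      have h1 : ContinuousOn (fun t : ℝ => fderiv ℝ F (t, x)) (Icc 0 1) :=
        (hF.continuousOn_fderiv_of_isOpen hW (by simp)).comp (by fun_prop) (hV x hx)
      exact h1.clm_apply continuousOn_const
  have hint : ∀ x ∈ V, ∀ u, IntervalIntegrable (fun t => fderiv ℝ F (t, x) (0, u))
      MeasureTheory.volume 0 1 := fun x hx u =>
    ContinuousOn.intervalIntegrable (by rw [uIcc_of_le zero_le_one]; exact hcont x hx u)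
  refine ⟨α, V, hVo, h0V, hVU, contDiffOn_parametric_integral hW hF hV, by simp [α, F], ?_, ?_⟩
  · ext1 u
    rw [hα 0 h0V]
    have : ∀ t ∈ uIcc (0 : ℝ) 1, fderiv ℝ F (t, 0) (0, u) = 0 := fun t ht => by
      rw [hFd _ _ _ (hV 0 h0V t (by rwa [uIcc_of_le zero_le_one] at ht))]
      simp [hβ0]
    rw [intervalIntegral.integral_congr this]
    simp
  · intro x hx u w
    rw [hα x hx, hα x hx, ContinuousLinearMap.intervalIntegral_apply (hint x hx u),
      ContinuousLinearMap.intervalIntegral_apply (hint x hx w)]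
    have hi : ∀ u w, IntervalIntegrable (fun t => fderiv ℝ F (t, x) (0, u) w)
        MeasureTheory.volume 0 1 := fun u w => ContinuousOn.intervalIntegrable (by
      rw [uIcc_of_le zero_le_one]; exact (hcont x hx u).clm_apply continuousOn_const)
    rw [← intervalIntegral.integral_sub (hi u w) (hi w u)]
    -- Closedness turns the antisymmetrized derivative of `F` into the radial derivative of `t²
    -- β_{tx}(u, w)`, which integrates to `β x u w`.
    have key : ∀ t ∈ uIcc (0 : ℝ) 1, HasDerivAt (fun s : ℝ => s ^ 2 * β (s • x) u w)
        (fderiv ℝ F (t, x) (0, u) w - fderiv ℝ F (t, x) (0, w) u) t := fun t ht => by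
      rw [uIcc_of_le zero_le_one] at ht
      have htx : t • x ∈ U := hV x hx t ht
      have h1 : HasDerivAt (fun s : ℝ => s • x) x t := by
        simpa using (hasDerivAt_id t).smul_const x
      have h2 : HasDerivAt (fun s : ℝ => β (s • x)) (fderiv ℝ β (t • x) x) t :=
        HasFDerivAt.comp_hasDerivAt (l := β) (f := fun s : ℝ => s • x) t (hβd _ htx) h1
      have h3 : HasDerivAt (fun s : ℝ => β (s • x) u w) (fderiv ℝ β (t • x) x u w) t := by
        simpa using (h2.clm_apply (hasDerivAt_const t u)).clm_apply (hasDerivAt_const t w)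
      refine (((hasDerivAt_id t).fun_pow 2).mul h3).congr_deriv ?_
      rw [hFd _ _ _ (hV x hx t ht), hFd _ _ _ (hV x hx t ht)]
      have h4 := hclosed _ htx x u w
      have h5 := hskew _ htx u w
      simp
      linear_combination t ^ 2 * h4 + t * h5
    rw [intervalIntegral.integral_eq_sub_of_hasDerivAt key ((hi u w).sub (hi w u))]
    simp

theorem hasDerivWithinAt_bilinear_apply {b : ℝ → E →L[ℝ] E →L[ℝ] ℝ} {b' : E →L[ℝ] E →L[ℝ] ℝ}
    {u w : ℝ → E} {u' w' : E} {s : Set ℝ} {t : ℝ} (hb : HasDerivWithinAt b b' s t)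
    (hu : HasDerivWithinAt u u' s t) (hw : HasDerivWithinAt w w' s t) :
    HasDerivWithinAt (fun r => b r (u r) (w r))
      (b' (u t) (w t) + b t u' (w t) + b t (u t) w') s t := by
  simpa using (hb.clm_apply hu).clm_apply hw

/-- The derivative of the relation `ι_X (B₀ + t β) = -α` in a spatial direction. -/
theorem fderiv_contraction {B₀ : E →L[ℝ] E →L[ℝ] ℝ} {β : E → E →L[ℝ] E →L[ℝ] ℝ}
    {α : E → E →L[ℝ] ℝ} {X : ℝ × E → E} {W : Set (ℝ × E)} (hW : IsOpen W)
    (hX : ContDiffOn ℝ ∞ X W) {t : ℝ} {q : E} (hβ : DifferentiableAt ℝ β q)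
    (hα : DifferentiableAt ℝ α q) (hXα : ∀ p ∈ W, (B₀ + p.1 • β p.2) (X p) = -α p.2)
    (hp : (t, q) ∈ W) (y : E) :
    t • fderiv ℝ β q y (X (t, q)) + (B₀ + t • β q) (fderiv ℝ X (t, q) (0, y)) =
      -fderiv ℝ α q y := by
  have f1 : HasFDerivAt (fun q : E => X (t, q))
      ((fderiv ℝ X (t, q)).comp (ContinuousLinearMap.inr ℝ ℝ E)) q :=
    (((hX.contDiffAt (hW.mem_nhds hp)).differentiableAt (by simp)).hasFDerivAt).comp q
      (hasFDerivAt_prodMk_right t q)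
  have f0 : HasFDerivAt (fun q : E => B₀ + t • β q) (t • fderiv ℝ β q) q :=
    HasFDerivAt.const_add_smul (F := E →L[ℝ] E →L[ℝ] ℝ) hβ.hasFDerivAt B₀ t
  have f2 := f0.clm_apply f1
  have f4 := hα.hasFDerivAt.fun_neg.congr_of_eventuallyEq
    (f₁ := fun q : E => (B₀ + t • β q) (X (t, q))) (by
      have hc : Continuous fun q : E => (t, q) := by fun_prop
      filter_upwards [hc.continuousAt.eventually (hW.mem_nhds hp)] with q hq using hXα _ hq)
  have f5 := congrArg (fun L => L y) (f2.unique f4)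
  refine Eq.trans ?_ f5
  simp [add_comm]

variable [CompleteSpace E]

theorem hasDerivWithinAt_of_eq_add_primitive {γ g : C(Icc (0 : ℝ) 1, E)} {x : E}
    (h : γ = constCurve E x + primitive E g) (t : Icc (0 : ℝ) 1) :
    HasDerivWithinAt (IccExtend zero_le_one γ) (g t) (Icc 0 1) t := by
  have h1 := (hasDerivWithinAt_primitive g t).const_add x
  rw [h]
  exact h1

/-- Local flow, up to time one, of a time-dependent vector field that vanishes to second order
at the origin. The flow and its derivative satisfy the integral equations. -/
theorem exists_flow {X : ℝ × E → E} {W : Set (ℝ × E)} (hW : IsOpen W) (hX : ContDiffOn ℝ ∞ X W)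
    (hW0 : ∀ t ∈ Icc (0 : ℝ) 1, (t, (0 : E)) ∈ W)
    (hX0 : ∀ t ∈ Icc (0 : ℝ) 1, X (t, 0) = 0)
    (hX1 : ∀ t ∈ Icc (0 : ℝ) 1, ∀ v, fderiv ℝ X (t, 0) (0, v) = 0) :
    ∃ (Γ : E → C(Icc (0 : ℝ) 1, E)) (V : Set E), IsOpen V ∧ 0 ∈ V ∧ ContDiffOn ℝ ∞ Γ V ∧
      Γ 0 = 0 ∧ fderiv ℝ Γ 0 = constCurve E ∧
      (∀ x ∈ V, ∀ t : Icc (0 : ℝ) 1, ((t : ℝ), Γ x t) ∈ W) ∧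
      (∀ x ∈ V, Γ x = constCurve E x + primitive E (superposition X (graphCurve (Γ x)))) ∧
      (∀ x ∈ V, ∀ v, fderiv ℝ Γ x v = constCurve E v +
        primitive E (superpositionDeriv X (Γ x) (fderiv ℝ Γ x v))) := by
  set O : Set C(Icc (0 : ℝ) 1, E) := {γ | ∀ t : Icc (0 : ℝ) 1, ((t : ℝ), γ t) ∈ W}
  have hO : IsOpen O := (isOpen_setOf_forall_mem hW).preimage (contDiff_graphCurve (E := E)).continuous
  have hO0 : (0 : C(Icc (0 : ℝ) 1, E)) ∈ O := fun t => hW0 t t.2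
  set N : C(Icc (0 : ℝ) 1, E) → C(Icc (0 : ℝ) 1, E) := fun γ => superposition X (graphCurve γ)
  have hN : ContDiffOn ℝ ∞ N O := contDiffOn_superposition_graphCurve hW hX
  -- A curve `γ` solves the flow equation with initial point `x` exactly when `Ψ γ` is the constant
  -- curve `x`.
  set Ψ : C(Icc (0 : ℝ) 1, E) → C(Icc (0 : ℝ) 1, E) := fun γ => γ - primitive E (N γ)
  have hΨ : ContDiffOn ℝ ∞ Ψ O := contDiffOn_id.sub ((primitive E).contDiff.comp_contDiffOn hN)
  have hΨ' : ∀ γ ∈ O, HasFDerivAt Ψ (ContinuousLinearMap.id ℝ _ -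
      (primitive E).comp (superpositionDeriv X γ)) γ := fun γ hγ =>
    (hasFDerivAt_id γ).sub ((primitive E).hasFDerivAt.comp γ
      (hasFDerivAt_superposition_graphCurve hW hX hγ))
  have hN0 : N 0 = 0 := by
    ext t
    change superposition X (graphCurve 0) t = 0
    rw [superposition_apply hX.continuousOn (γ := graphCurve 0) hO0]
    exact hX0 t t.2
  have hΨ0 : Ψ 0 = 0 := by simp [Ψ, hN0]
  have hS0 : superpositionDeriv X (0 : C(Icc (0 : ℝ) 1, E)) = 0 := by
    ext h t
    rw [superpositionDeriv_apply hW hX hO0]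
    exact hX1 t t.2 _
  -- Since the spatial derivative of `X` vanishes along the zero curve, `Ψ` has derivative the
  -- identity there, and the flow is a local inverse of `Ψ` restricted to constant curves.
  obtain ⟨χ, h0s, hsO, hχ, -, hχs⟩ := exists_openPartialHomeomorph_contDiffOn hO hΨ hO0
    (f' := ContinuousLinearEquiv.refl ℝ _) (by
      have := hΨ' 0 hO0
      rw [hS0, ContinuousLinearMap.comp_zero, sub_zero] at this
      exact this)
  have hχ0 : χ 0 = 0 := by rw [hχ, hΨ0]
  set V : Set E := constCurve E ⁻¹' χ.target
  have hV : IsOpen V := χ.open_target.preimage (constCurve E).continuous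
  have h0V : (0 : E) ∈ V := by
    have := χ.map_source h0s
    rw [hχ0] at this
    simpa [V] using this
  set Γ : E → C(Icc (0 : ℝ) 1, E) := fun x => χ.symm (constCurve E x)
  have hΓ : ContDiffOn ℝ ∞ Γ V := hχs.comp (constCurve E).contDiff.contDiffOn fun _ h => h
  have hΓO : ∀ x ∈ V, Γ x ∈ O := fun x hx => hsO (χ.map_target hx)
  have hΓeq : ∀ x ∈ V, Γ x = constCurve E x + primitive E (N (Γ x)) := fun x hx => by
    have h1 : Ψ (Γ x) = constCurve E x := by
      rw [← hχ]; exact χ.right_inv hx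
    rw [← h1]
    simp [Ψ]
  have hΓ0 : Γ 0 = 0 := by
    have := χ.left_inv h0s
    rw [hχ0] at this
    simpa [Γ] using this
  have hΓ' : ∀ x ∈ V, ∀ v, fderiv ℝ Γ x v = constCurve E v +
      primitive E (superpositionDeriv X (Γ x) (fderiv ℝ Γ x v)) := fun x hx v => by
    have hd : HasFDerivAt Γ (fderiv ℝ Γ x) x :=
      ((hΓ.contDiffAt (hV.mem_nhds hx)).differentiableAt (by simp)).hasFDerivAt
    have h1 : HasFDerivAt (fun x => constCurve E x + primitive E (N (Γ x))) _ x :=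
      (constCurve E).hasFDerivAt.add ((primitive E).hasFDerivAt.comp x
        ((hasFDerivAt_superposition_graphCurve hW hX (hΓO x hx)).comp x hd))
    have h2 := h1.congr_of_eventuallyEq (f₁ := Γ) (by
      filter_upwards [hV.mem_nhds hx] with y hy using hΓeq y hy)
    exact congrArg (fun L => L v) (hd.unique h2)
  refine ⟨Γ, V, hV, h0V, hΓ, hΓ0, ?_, hΓO, hΓeq, hΓ'⟩
  ext1 v
  rw [hΓ' 0 h0V, hΓ0, hS0]
  simp

/-- Moser's computation: pulling back `B₀ + t β` along the flow of `X` gives a constant. -/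
theorem apply_curves_eq_of_moser {B₀ : E →L[ℝ] E →L[ℝ] ℝ} {β : E → E →L[ℝ] E →L[ℝ] ℝ}
    {α : E → E →L[ℝ] ℝ} {X : ℝ × E → E} {W : Set (ℝ × E)} (hW : IsOpen W)
    (hX : ContDiffOn ℝ ∞ X W)
    (hβ : ∀ p ∈ W, DifferentiableAt ℝ β p.2) (hα : ∀ p ∈ W, DifferentiableAt ℝ α p.2)
    (hB₀ : ∀ v w, B₀ v w = -B₀ w v)
    (hskew : ∀ p ∈ W, ∀ v w, β p.2 v w = -β p.2 w v)
    (hclosed : ∀ p ∈ W, ∀ u v w,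
      fderiv ℝ β p.2 u v w - fderiv ℝ β p.2 v u w + fderiv ℝ β p.2 w u v = 0)
    (hprim : ∀ p ∈ W, ∀ u w, fderiv ℝ α p.2 u w - fderiv ℝ α p.2 w u = β p.2 u w)
    (hXα : ∀ p ∈ W, (B₀ + p.1 • β p.2) (X p) = -α p.2)
    {γ u w : C(Icc (0 : ℝ) 1, E)} (hγW : ∀ t : Icc (0 : ℝ) 1, ((t : ℝ), γ t) ∈ W) {x v z : E}
    (hγ : γ = constCurve E x + primitive E (superposition X (graphCurve γ)))
    (hu : u = constCurve E v + primitive E (superpositionDeriv X γ u))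
    (hw : w = constCurve E z + primitive E (superpositionDeriv X γ w)) :
    (B₀ + β (γ ⟨1, by simp⟩)) (u ⟨1, by simp⟩) (w ⟨1, by simp⟩) = B₀ v z := by
  set h : ℝ → ℝ := fun t => (B₀ + t • β (IccExtend zero_le_one γ t))
    (IccExtend zero_le_one u t) (IccExtend zero_le_one w t)
  have key : ∀ t : Icc (0 : ℝ) 1, HasDerivWithinAt h 0 (Icc 0 1) t := fun t => by
    have hp := hγW t
    have d1 := hasDerivWithinAt_of_eq_add_primitive hγ t
    have d2 := hasDerivWithinAt_of_eq_add_primitive hu t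
    have d3 := hasDerivWithinAt_of_eq_add_primitive hw t
    rw [superposition_apply hX.continuousOn (γ := graphCurve γ) hγW, graphCurve_apply] at d1
    rw [superpositionDeriv_apply hW hX hγW] at d2 d3
    have d4 : HasDerivWithinAt (fun s => β (IccExtend zero_le_one γ s))
        (fderiv ℝ β (γ t) (X (t, γ t))) (Icc 0 1) t := by
      have := (hβ _ hp).hasFDerivAt
      refine HasFDerivAt.comp_hasDerivWithinAt (l := β) (t : ℝ) ?_ d1
      rw [IccExtend_val]; exact this
    have d5 : HasDerivWithinAt (fun s : ℝ => B₀ + s • β (IccExtend zero_le_one γ s))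
        ((t : ℝ) • fderiv ℝ β (γ t) (X (t, γ t)) + β (IccExtend zero_le_one γ t))
        (Icc 0 1) t := by
      exact (hasDerivWithinAt_id_smul (F := E →L[ℝ] E →L[ℝ] ℝ) d4).const_add B₀
    have d6 := hasDerivWithinAt_bilinear_apply d5 d2 d3
    refine d6.congr_deriv ?_
    have e1 := fun y => fderiv_contraction hW hX (hβ _ hp) (hα _ hp) hXα hp y
    have e2 := congrArg (fun L => L (w t)) (e1 (u t))
    have e3 := congrArg (fun L => L (u t)) (e1 (w t))
    have e4 := hclosed _ hp (X (t, γ t)) (u t) (w t)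
    have e5 := hprim _ hp (u t) (w t)
    have e6 := hB₀ (u t) (fderiv ℝ X (t, γ t) (0, w t))
    have e7 := hskew _ hp (u t) (fderiv ℝ X (t, γ t) (0, w t))
    simp only [IccExtend_val]
    simp at e2 e3 e4 e5 e6 e7 ⊢
    -- Skew-symmetry and the differentiated relation for `X` reduce the derivative to `t dβ(X, u, w)
    -- + β(u, w) - dα(u, w)`: `e4` kills the first term and `e5` the rest.
    linear_combination e2 - e3 + (t : ℝ) * e4 - e5 + e6 + (t : ℝ) * e7
  have hconst : h 1 = h 0 := by
    refine constant_of_has_deriv_right_zero (a := 0) (b := 1) (fun t ht => ?_) (fun t ht => ?_) 1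
      (by simp)
    · exact (key ⟨t, ht⟩).continuousWithinAt
    · exact (key ⟨t, Ico_subset_Icc_self ht⟩).mono_of_mem_nhdsWithin
        (Icc_mem_nhdsGE_of_mem ht)
  have hu0 : u ⟨0, by simp⟩ = v := by rw [hu]; simp [primitive_apply]
  have hw0 : w ⟨0, by simp⟩ = z := by rw [hw]; simp [primitive_apply]
  simp only [h] at hconst
  rw [IccExtend_of_mem _ γ (by simp : (1 : ℝ) ∈ Icc (0 : ℝ) 1),
    IccExtend_of_mem _ u (by simp : (1 : ℝ) ∈ Icc (0 : ℝ) 1),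
    IccExtend_of_mem _ w (by simp : (1 : ℝ) ∈ Icc (0 : ℝ) 1),
    IccExtend_of_mem _ u (by simp : (0 : ℝ) ∈ Icc (0 : ℝ) 1),
    IccExtend_of_mem _ w (by simp : (0 : ℝ) ∈ Icc (0 : ℝ) 1), hu0, hw0] at hconst
  simpa using hconst

omit [CompleteSpace E] in
theorem contDiffOn_const_add_smul {F : Type*} [NormedAddCommGroup F] [NormedSpace ℝ F]
    {f : E → F} {V : Set E} (hf : ContDiffOn ℝ ∞ f V) (c : F) :
    ContDiffOn ℝ ∞ (fun p : ℝ × E => c + p.1 • f p.2) (Prod.snd ⁻¹' V) :=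
  contDiffOn_const.add (contDiffOn_fst.smul (hf.comp contDiffOn_snd fun _ h => h))

omit [CompleteSpace E] in
theorem contDiffOn_clm_comp {F G : Type*} [NormedAddCommGroup F] [NormedSpace ℝ F]
    [NormedAddCommGroup G] [NormedSpace ℝ G] (T : G →L[ℝ] F) {f : E → G} {U : Set E}
    (hf : ContDiffOn ℝ ∞ f U) : ContDiffOn ℝ ∞ (fun x => T (f x)) U :=
  T.contDiff.comp_contDiffOn hf

omit [CompleteSpace E] in
theorem fderiv_clm_comp_apply {F G : Type*} [NormedAddCommGroup F] [NormedSpace ℝ F]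
    [NormedAddCommGroup G] [NormedSpace ℝ G] (T : G →L[ℝ] F) {f : E → G} {x : E}
    (hf : DifferentiableAt ℝ f x) (u : E) :
    fderiv ℝ (fun x => T (f x)) x u = T (fderiv ℝ f x u) :=
  congrArg (fun L => L u) (T.hasFDerivAt.comp x hf.hasFDerivAt).fderiv

/-- Darboux's theorem for closed skew-symmetric bilinear form fields: near a point where the form is
nondegenerate, it is the pullback of a constant form. -/
theorem exists_pullback_eq_const {B : E → E →L[ℝ] E →L[ℝ] ℝ} {U : Set E}
    (hU : IsOpen U) (hU0 : 0 ∈ U) (hB : ContDiffOn ℝ ∞ B U)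
    (hskew : ∀ x ∈ U, ∀ v w, B x v w = -B x w v)
    (hclosed : ∀ x ∈ U, ∀ u v w,
      fderiv ℝ B x u v w - fderiv ℝ B x v u w + fderiv ℝ B x w u v = 0)
    (hinv : (B 0).IsInvertible) :
    ∃ φ : OpenPartialHomeomorph E E, 0 ∈ φ.target ∧ φ.target ⊆ U ∧
      ContDiffOn ℝ ∞ φ φ.source ∧ ContDiffOn ℝ ∞ φ.symm φ.target ∧
      ∀ x ∈ φ.source, ∀ v w, B (φ x) (fderiv ℝ φ x v) (fderiv ℝ φ x w) = B 0 v w := by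
  set β : E → E →L[ℝ] E →L[ℝ] ℝ := fun x => B x - B 0
  have hβ : ContDiffOn ℝ ∞ β U := hB.sub contDiffOn_const
  have hβ0 : β 0 = 0 := by ext v w; simp [β]
  have hβ' : ∀ x, fderiv ℝ β x = fderiv ℝ B x := fun x =>
    fderiv_sub_const (𝕜 := ℝ) (F := E →L[ℝ] E →L[ℝ] ℝ) (f := B) (x := x) (B 0)
  have hβskew : ∀ x ∈ U, ∀ v w, β x v w = -β x w v := fun x hx v w => by
    simp only [β, sub_apply]
    linear_combination hskew x hx v w - hskew 0 hU0 v w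
  have hβclosed : ∀ x ∈ U, ∀ u v w,
      fderiv ℝ β x u v w - fderiv ℝ β x v u w + fderiv ℝ β x w u v = 0 := fun x hx => by
    rw [hβ']; exact hclosed x hx
  obtain ⟨α, V, hVo, h0V, hVU, hα, hα0, hα1, hprim⟩ :=
    exists_primitive_oneForm hU hU0 hβ hβ0 hβskew hβclosed
  have hβd : ∀ x ∈ V, DifferentiableAt ℝ β x := fun x hx =>
    (hβ.contDiffAt (hU.mem_nhds (hVU hx))).differentiableAt (by simp)
  have hαd : ∀ x ∈ V, DifferentiableAt ℝ α x := fun x hx =>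
    (hα.contDiffAt (hVo.mem_nhds hx)).differentiableAt (by simp)
  set b : ℝ × E → E →L[ℝ] E →L[ℝ] ℝ := fun p => B 0 + p.1 • β p.2
  have hbs : ContDiffOn ℝ ∞ b (Prod.snd ⁻¹' V) :=
    contDiffOn_const_add_smul (F := E →L[ℝ] E →L[ℝ] ℝ) (hβ.mono hVU) (B 0)
  -- The Moser equation is solvable where `B 0 + t β` is invertible. This open set contains all `(t,
  -- 0)`, because `β 0 = 0`.
  set W : Set (ℝ × E) := Prod.snd ⁻¹' V ∩
    b ⁻¹' range ((↑) : (E ≃L[ℝ] (E →L[ℝ] ℝ)) → E →L[ℝ] E →L[ℝ] ℝ)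
  have hW : IsOpen W := hbs.continuousOn.isOpen_inter_preimage (hVo.preimage continuous_snd)
    ContinuousLinearEquiv.isOpen
  have hW0 : ∀ t : ℝ, (t, (0 : E)) ∈ W := fun t => ⟨h0V, by
    obtain ⟨e, he⟩ := hinv
    exact ⟨e, he.trans (by ext v w; simp [b, hβ0])⟩⟩
  have hWV : ∀ p ∈ W, p.2 ∈ V := fun p hp => hp.1
  set A : ℝ × E → (E →L[ℝ] ℝ) →L[ℝ] E := fun p => (b p).inverse
  have hA : ContDiffOn ℝ ∞ A W := fun p hp =>
    (ContinuousLinearMap.IsInvertible.contDiffAt_map_inverse hp.2).comp_contDiffWithinAt p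
      ((hbs p hp.1).mono inter_subset_left)
  have hα2 : ContDiffOn ℝ ∞ (fun p : ℝ × E => α p.2) W := hα.comp contDiffOn_snd hWV
  set X : ℝ × E → E := fun p => -A p (α p.2)
  have hX : ContDiffOn ℝ ∞ X W := (hA.clm_apply hα2).neg
  have hXα : ∀ p ∈ W, (B 0 + p.1 • β p.2) (X p) = -α p.2 := fun p hp => by
    obtain ⟨e, he⟩ := hp.2
    change b p (-((b p).inverse (α p.2))) = -α p.2
    rw [← he, ContinuousLinearMap.inverse_equiv]
    simp
  -- `X` is linear in `α`, so it inherits the second-order vanishing at the origin. The time-one map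
  -- then has derivative the identity at `0`.
  have hX1 : ∀ t : ℝ, ∀ v, fderiv ℝ X (t, 0) (0, v) = 0 := fun t v => by
    have h1 : HasFDerivAt A (fderiv ℝ A (t, 0)) (t, 0) :=
      ((hA.contDiffAt (hW.mem_nhds (hW0 t))).differentiableAt (by simp)).hasFDerivAt
    have h2 : HasFDerivAt (fun p : ℝ × E => α p.2) _ (t, 0) :=
      HasFDerivAt.comp (g := α) (t, 0) (hαd 0 h0V).hasFDerivAt hasFDerivAt_snd
    have h3 : HasFDerivAt X _ (t, 0) := (h1.clm_apply h2).neg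
    rw [h3.fderiv]
    simp [hα0, hα1]
  obtain ⟨Γ, O, hO, h0O, hΓ, hΓ0, hΓ1, hΓW, hΓeq, hΓ'⟩ := exists_flow hW hX (fun t _ => hW0 t)
    (fun t _ => by simp [X, hα0]) (fun t _ => hX1 t)
  set ev : C(Icc (0 : ℝ) 1, E) →L[ℝ] E := ContinuousMap.evalCLM ℝ ⟨1, by simp⟩
  have hφ : ContDiffOn ℝ ∞ (fun x => ev (Γ x)) O := ev.contDiff.comp_contDiffOn hΓ
  have hφ' : ∀ x ∈ O, HasFDerivAt (fun x => ev (Γ x)) (ev.comp (fderiv ℝ Γ x)) x := fun x hx =>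
    ev.hasFDerivAt.comp x
      ((hΓ.contDiffAt (hO.mem_nhds hx)).differentiableAt (by simp)).hasFDerivAt
  obtain ⟨χ, h0χ, hχO, hχ, hs, hs'⟩ := exists_openPartialHomeomorph_contDiffOn hO hφ h0O
    (f' := ContinuousLinearEquiv.refl ℝ E) (by
      have h1 := hφ' 0 h0O
      rw [hΓ1] at h1
      exact h1)
  refine ⟨χ, ?_, ?_, hs, hs', fun x hx v w => ?_⟩
  · have h1 := χ.map_source h0χ
    rw [hχ] at h1
    simpa [hΓ0] using h1
  -- A point of the target is the endpoint of a flow line, and flow lines stay in `W`, which lies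
  -- over `V ⊆ U`.
  · intro y hy
    have h1 := hVU (hWV _ (hΓW _ (hχO (χ.map_target hy)) ⟨1, by simp⟩))
    have h2 := χ.right_inv hy
    rw [hχ] at h2
    rw [← h2]
    exact h1
  · have hxO := hχO hx
    have h1 := apply_curves_eq_of_moser hW hX (fun p hp => hβd _ (hWV p hp))
      (fun p hp => hαd _ (hWV p hp)) (hskew 0 hU0) (fun p hp => hβskew _ (hVU (hWV p hp)))
      (fun p hp => hβclosed _ (hVU (hWV p hp))) (fun p hp => hprim _ (hWV p hp)) hXα
      (hΓW x hxO) (hΓeq x hxO) (hΓ' x hxO v) (hΓ' x hxO w)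
    rw [hχ, (hφ' x hxO).fderiv, ← h1]
    simp [β, ev]

end Moser

/-! ### Symplectic forms in coordinate space. -/

/-- A `2`-form as a bilinear map. -/
noncomputable def bilinearOfForm (E : Type*) [NormedAddCommGroup E] [NormedSpace ℝ E] :
    (E [⋀^Fin 2]→L[ℝ] ℝ) →L[ℝ] E →L[ℝ] E →L[ℝ] ℝ :=
  (ContinuousLinearMap.compL ℝ E (E [⋀^Fin 1]→L[ℝ] ℝ) (E →L[ℝ] ℝ)
    (ContinuousAlternatingMap.ofSubsingletonLIE (𝕜 := ℝ) (E := E) (F := ℝ) (0 : Fin 1)).symm.toContinuousLinearEquiv).comp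
    (ContinuousAlternatingMap.curryLeftLI (𝕜 := ℝ) (E := E) (F := ℝ) (n := 1)).toContinuousLinearMap

theorem bilinearOfForm_apply {E : Type*} [NormedAddCommGroup E] [NormedSpace ℝ E]
    (ω' : E [⋀^Fin 2]→L[ℝ] ℝ) (v w : E) : bilinearOfForm E ω' v w = ω' ![v, w] := by
  change ω' (Matrix.vecCons v fun _ => w) = ω' ![v, w]
  congr 1
  ext i
  fin_cases i <;> rfl

theorem isInvertible_of_injective {E : Type*} [NormedAddCommGroup E] [NormedSpace ℝ E]
    [FiniteDimensional ℝ E] {b : E →L[ℝ] E →L[ℝ] ℝ} (hb : Function.Injective b) :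
    b.IsInvertible := by
  have hdim : Module.finrank ℝ E = Module.finrank ℝ (E →L[ℝ] ℝ) :=
    (Subspace.dual_finrank_eq (K := ℝ) (V := E)).symm.trans
      (LinearMap.toContinuousLinearMap (𝕜 := ℝ) (E := E) (F' := ℝ)).finrank_eq
  have : FiniteDimensional ℝ (E →L[ℝ] ℝ) :=
    (LinearMap.toContinuousLinearMap (𝕜 := ℝ) (E := E) (F' := ℝ)).finiteDimensional
  exact ⟨(LinearEquiv.ofInjectiveOfFinrankEq (b : E →ₗ[ℝ] E →L[ℝ] ℝ) hb hdim).toContinuousLinearEquiv,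
    by ext; rfl⟩

/-- Through `bilinearOfForm`, the vanishing of `extDeriv` becomes the three-term cyclic identity,
and in finite dimension nondegeneracy becomes invertibility, so `exists_pullback_eq_const` applies.
-/
theorem hasFlatCoordinates_of_closed {n : ℕ} {η : Coord n → Coord n [⋀^Fin 2]→L[ℝ] ℝ}
    {U : Set (Coord n)} (hU : IsOpen U) (hU0 : 0 ∈ U) (hη : ContDiffOn ℝ ∞ η U)
    (hclosed : ∀ x ∈ U, extDeriv η x = 0)
    (h0 : ∀ v, (∀ w, η 0 ![v, w] = 0) → v = 0) : HasFlatCoordinates η U := by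
  set T := bilinearOfForm (Coord n)
  have hT : ∀ x v w, T (η x) v w = η x ![v, w] := fun x => bilinearOfForm_apply (η x)
  obtain ⟨φ, h1, h2, h3, h4, h5⟩ := exists_pullback_eq_const (B := fun x => T (η x)) hU hU0
    (contDiffOn_clm_comp (F := Coord n →L[ℝ] Coord n →L[ℝ] ℝ) T hη) (fun x _ v w => by
      rw [hT, hT]
      have : η x (![v, w] ∘ Equiv.swap 0 1) = -η x ![v, w] :=
        (η x).toAlternatingMap.map_swap ![v, w] (by simp)
      rw [← neg_eq_iff_eq_neg, ← this]
      congr 1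
      ext i
      fin_cases i <;> rfl)
    (fun x hx u v w => by
      have hd := fderiv_clm_comp_apply (F := Coord n →L[ℝ] Coord n →L[ℝ] ℝ) T
        ((hη.contDiffAt (hU.mem_nhds hx)).differentiableAt (by simp))
      have h := congrArg (fun L => L ![u, v, w]) (hclosed x hx)
      rw [hd, hd, hd]
      simp only [T, bilinearOfForm_apply]
      simp only [extDeriv, ContinuousAlternatingMap.alternatizeUncurryFin_apply] at h
      have h := (Fin.sum_univ_three _).symm.trans h
      have e0 : Fin.removeNth 0 ![u, v, w] = ![v, w] := by ext i; fin_cases i <;> rfl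
      have e1 : Fin.removeNth 1 ![u, v, w] = ![u, w] := by ext i; fin_cases i <;> rfl
      have e2 : Fin.removeNth 2 ![u, v, w] = ![u, v] := by ext i; fin_cases i <;> rfl
      rw [e0, e1, e2] at h
      simpa [sub_eq_add_neg] using h)
    (isInvertible_of_injective ((injective_iff_map_eq_zero _).2 fun v hv =>
      h0 v fun w => by rw [← hT, hv]; rfl))
  refine ⟨φ, h1, h2, h3, h4, η 0, fun y hy => ?_⟩
  ext m
  have h6 := h5 y hy (m 0) (m 1)
  rw [hT, hT] at h6
  simp only [ContinuousAlternatingMap.compContinuousLinearMap_apply]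
  convert h6 using 2
  · ext i
    fin_cases i <;> rfl
  · ext i
    fin_cases i <;> rfl

/-! ### Transfer of the hypotheses from the manifold to charts. -/

section Manifold

variable {n : ℕ} {M : Type*} [TopologicalSpace M] [ChartedSpace (Coord n) M]

theorem mfderiv_symm_bijective {e : OpenPartialHomeomorph M (Coord n)}
    (he : e ∈ IsManifold.maximalAtlas (𝓡 n) ∞ M) {x : Coord n} (hx : x ∈ e.target) :
    Function.Bijective (mfderiv (𝓡 n) (𝓡 n) e.symm x) := by
  have hd : e.MDifferentiable (𝓡 n) (𝓡 n) :=
    ⟨(contMDiffOn_of_mem_maximalAtlas he).mdifferentiableOn (by simp),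
      (contMDiffOn_symm_of_mem_maximalAtlas he).mdifferentiableOn (by simp)⟩
  exact hd.symm.mfderiv_bijective hx

end Manifold

end Darboux

open Darboux in
theorem mainTheorem3 (n : ℕ) (M : Type*) [TopologicalSpace M]
    [ChartedSpace (Darboux.Coord n) M] [IsManifold (𝓡 n) ∞ M] :
    (∀ η : Darboux.DifferentialForm n n M, η.IsVolumeForm → η.IsFlat) ∧
      (∀ η : Darboux.DifferentialForm n 2 M, η.IsSymplectic → η.IsFlat) := by
  refine ⟨fun η hη p => ?_, fun η hη p => ?_⟩ <;>
    obtain ⟨e, he, hp, hp0⟩ := exists_centered_chart (n := n) p <;>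
    have h0 : (0 : Coord n) ∈ e.target := hp0 ▸ e.map_source hp
  · refine η.isFlatAt_of_hasFlatCoordinates he hp hp0
      (hasFlatCoordinates_of_ne_zero e.open_target h0 (η.smooth e he) fun h => ?_)
    refine hη (e.symm 0) ?_
    ext v
    -- Every tuple of tangent vectors comes from coordinate vectors, so a form vanishing in the
    -- chart at `0` vanishes on the tangent space.
    choose u hu using fun i => (mfderiv_symm_bijective he h0).2 (v i)
    have h1 := congrArg (fun L => L u) h
    obtain rfl : (fun i => mfderiv (𝓡 n) (𝓡 n) e.symm 0 (u i)) = v := funext hu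
    exact h1
  · refine η.isFlatAt_of_hasFlatCoordinates he hp hp0
      (hasFlatCoordinates_of_closed e.open_target h0 (η.smooth e he) (hη.1 e he) fun v hv => ?_)
    -- Injectivity of the chart derivative reduces `v = 0` to the vanishing of its image, which
    -- nondegeneracy on the manifold gives once the second argument is lifted to coordinates.
    refine (mfderiv_symm_bijective he h0).1 (Eq.trans ?_ (map_zero _).symm)
    refine hη.2 (e.symm 0) ?_
    ext w
    obtain ⟨z, hz⟩ := (mfderiv_symm_bijective he h0).2 (w 0)
    have h1 := hv z
    change η.toField (e.symm 0) (fun i => mfderiv (𝓡 n) (𝓡 n) e.symm 0 (![v, z] i)) = 0 at h1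
    have h2 : (fun i => mfderiv (𝓡 n) (𝓡 n) e.symm 0 (![v, z] i)) =
        Matrix.vecCons (mfderiv (𝓡 n) (𝓡 n) e.symm 0 v) w := by
      funext i
      fin_cases i
      · rfl
      · exact hz
    rw [h2] at h1
    refine h1.trans (Eq.symm ?_)
    exact (η.toField (e.symm 0)).map_coord_zero (m := Matrix.vecCons 0 w) 0 rfl
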